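/- Let $p,q\ge 1$, $k\ge 1$, $n\ge 1$ be integers and let $\phi_1,\phi_2,\dots:\mathbb{R}\to[-1,1]$ be (measurable) basis functions. Let $\mathcal{F}_{2k+1}$ be the set of labeled binary trees with at most $2k+1$ nodes in which every non-leaf node has two children and is labeled $+$ or $*$, and every leaf is labeled by a function $\phi_i(x_j)$ with $1\le i\le q$, $1\le j\le p$. For $f\in\mathcal{F}_{2k+1}$, let $\mathcal{W}(f)$ be the set of functions $g:\mathbb{R}^p\to\mathbb{R}$ obtained by attaching a real weight to each leaf of $f$ (a leaf $\phi_i(x_j)$ with weight $w$ takes the value $w\,\phi_i(x_j)$) and evaluating the tree, where the vector $\mathbf{w}$ of all leaf weights satisfies $\|\mathbf{w}\|_1\le 1$. Let $\mathcal{Y}\subseteq\mathbb{R}$, and let $d:\mathcal{Y}\times\mathbb{R}\to[0,1]$ be a (measurable) loss such that $t\mapsto d(y,t)$ is $1$-Lipschitz for every $y\in\mathcal{Y}$. Put $\mathcal{Z}=\mathbb{R}^p\times\mathcal{Y}$ and $\mathcal{H}(f)=\{h:\mathcal{Z}\to[0,1] : h(x,y)=d(y,g(x)),\ g\in\mathcal{W}(f)\}$.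 Let $\mathcal{D}$ be any probability distribution on $\mathcal{Z}$, let $S=\{z_1,\dots,z_n\}$ be $n$ i.i.d. samples from $\mathcal{D}$, and write $\mathbb{E}_{\mathcal{D}}[h]=\mathbb{E}_{z\sim\mathcal{D}}[h(z)]$ and $\widehat{\mathbb{E}}_S[h]=\frac1n\sum_{i=1}^n h(z_i)$. Then for every $\delta\in(0,1)$, with probability at least $1-\delta$ over the choice of $S$, simultaneously for all $f\in\mathcal{F}_{2k+1}$ and all $h\in\mathcal{H}(f)$, $$\mathbb{E}_{\mathcal{D}}[h]\le\widehat{\mathbb{E}}_S[h]+2\sqrt{\frac{k+1}{n}}+\sqrt{\frac{(k+1)\log(pq)+\log(8k\cdot k!)+\log(1/\delta)}{2n}}.$$ -/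

import Mathlib

open MeasureTheory ProbabilityTheory

noncomputable section

/-- The two possible labels of a non-leaf node. -/
inductive NodeOp
  | add
  | mul

/-- The operation on real numbers named by a label. -/
def NodeOp.apply : NodeOp → ℝ → ℝ → ℝ
  | .add, a, b => a + b
  | .mul, a, b => a * b

/-- Labeled binary trees: a leaf carries a basis function index `i` (out of `q`) and a coordinate
index `j` (out of `p`), standing for `φ i (x j)`; a non-leaf node carries `+` or `*` and has
two subtrees. -/
inductive LabeledTree (p q : ℕ)
  | leaf (i : Fin q) (j : Fin p)
  | node (op : NodeOp) (l r : LabeledTree p q)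

namespace LabeledTree

variable {p q : ℕ}

/-- The total number of nodes (leaves and operations). -/
def numNodes : LabeledTree p q → ℕ
  | leaf _ _ => 1
  | node _ l r => l.numNodes + r.numNodes + 1

/-- The number of leaves. -/
def numLeaves : LabeledTree p q → ℕ
  | leaf _ _ => 1
  | node _ l r => l.numLeaves + r.numLeaves

/-- The value at `x` of the tree `f` whose leaves, read from left to right, carry the weights `w`:
a leaf `(i, j)` with weight `a` has value `a * φ i (x j)`. -/
def eval (φ : ℕ → ℝ → ℝ) (x : Fin p → ℝ) :
    (f : LabeledTree p q) → (Fin f.numLeaves → ℝ) → ℝ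
  | leaf i j, w => w (0 : Fin 1) * φ i (x j)
  | node op l r, w =>
      op.apply (eval φ x l fun a => w (Fin.castAdd r.numLeaves a))
        (eval φ x r fun a => w (Fin.natAdd l.numLeaves a))

end LabeledTree

/-- `treeClass p q m`: the labeled binary trees with at most `m` nodes. -/
def treeClass (p q m : ℕ) : Set (LabeledTree p q) := {f | f.numNodes ≤ m}

/-- The functions of the weighted labeled binary trees with structure `f` and leaf weights `w`
satisfying `‖w‖₁ ≤ 1`. -/
def weightedTrees {p q : ℕ} (φ : ℕ → ℝ → ℝ) (f : LabeledTree p q) : Set ((Fin p → ℝ) → ℝ) :=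
  {g | ∃ w : Fin f.numLeaves → ℝ, ∑ a, |w a| ≤ 1 ∧ g = fun x => f.eval φ x w}

/-- The losses `z = (x, y) ↦ d (y, g x)` of the weighted trees `g` with structure `f`. -/
def lossClass {p q : ℕ} {Y : Set ℝ} (φ : ℕ → ℝ → ℝ) (d : Y → ℝ → ℝ) (f : LabeledTree p q) :
    Set ((Fin p → ℝ) × Y → ℝ) :=
  {h | ∃ g ∈ weightedTrees φ f, h = fun z => d z.2 (g z.1)}

/-- The true risk. -/
def trueRisk {Z : Type*} [MeasurableSpace Z] (D : Measure Z) (h : Z → ℝ) : ℝ := ∫ z, h z ∂D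

/-- The empirical risk on the sample `S`. -/
def empiricalRisk {Z : Type*} {n : ℕ} (S : Fin n → Z) (h : Z → ℝ) : ℝ :=
  (1 / (n : ℝ)) * ∑ i, h (S i)

end

/-! Each tree `f` with `m` leaves is handled separately, and a union bound over the finitely many
trees concludes. For one tree, bounded differences concentrate the largest deviation around its
mean, symmetrization bounds the mean by twice a Rademacher average, and contraction removes the
loss. What remains is to bound the Rademacher average of the weighted trees by `√(m / n)`. Expanding
`f` in its leaf weights gives products of basis functions, all bounded by one. A linear functional
bounded by `B` on these monomials is bounded by `B` on every weighted tree with `‖w‖₁ ≤ 1`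
(`abs_apply_eval_le`), so the supremum over weights is controlled by a maximum over the `N`
monomials. Since `N ^ 3 ≤ 3 ^ m`, either `N ≤ m`, where second moments suffice, or `2 N ≤ exp (m /
2)`, where exponential moments do (`signAvg_iSup_eval_le`). This yields the exact constant. There
are at most `8 k · k! · (p q) ^ (k + 1)` trees, by Catalan numbers. Suprema over weights are reduced
to finite maxima along a dense sequence, which also settles measurability. -/

/-! ### Averages over sign vectors -/

/-- The average of `F` over all sign vectors in `{1, -1} ^ n`. -/
noncomputable def signAvg : (n : ℕ) → ((Fin n → ℝ) → ℝ) → ℝ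
  | 0, F => F Fin.elim0
  | n + 1, F => (signAvg n (fun s => F (Fin.cons 1 s)) + signAvg n (fun s => F (Fin.cons (-1) s))) / 2

/-- Vectors all of whose entries are `1` or `-1`. -/
def IsSignVector {n : ℕ} (s : Fin n → ℝ) : Prop := ∀ i, s i = 1 ∨ s i = -1

lemma IsSignVector.cons_one {n : ℕ} {s : Fin n → ℝ} (hs : IsSignVector s) :
    IsSignVector (Fin.cons 1 s : Fin (n + 1) → ℝ) := by
  intro i
  refine Fin.cases (Or.inl (by simp)) (fun i => ?_) i
  simpa using hs i

lemma IsSignVector.cons_neg_one {n : ℕ} {s : Fin n → ℝ} (hs : IsSignVector s) :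
    IsSignVector (Fin.cons (-1) s : Fin (n + 1) → ℝ) := by
  intro i
  refine Fin.cases (Or.inr (by simp)) (fun i => ?_) i
  simpa using hs i

lemma signAvg_mono {n : ℕ} {F G : (Fin n → ℝ) → ℝ} (h : ∀ s, IsSignVector s → F s ≤ G s) :
    signAvg n F ≤ signAvg n G := by
  induction n with
  | zero => exact h _ (fun i => i.elim0)
  | succ n ih =>
    have h1 := ih (F := fun s => F (Fin.cons 1 s)) (G := fun s => G (Fin.cons 1 s))
      fun s hs => h _ hs.cons_one
    have h2 := ih (F := fun s => F (Fin.cons (-1) s)) (G := fun s => G (Fin.cons (-1) s))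
      fun s hs => h _ hs.cons_neg_one
    simp only [signAvg]
    linarith

lemma signAvg_const {n : ℕ} (c : ℝ) : signAvg n (fun _ => c) = c := by
  induction n with
  | zero => rfl
  | succ n ih => simp [signAvg, ih]

lemma signAvg_add {n : ℕ} (F G : (Fin n → ℝ) → ℝ) :
    signAvg n (fun s => F s + G s) = signAvg n F + signAvg n G := by
  induction n with
  | zero => rfl
  | succ n ih => simp only [signAvg, ih]; ring

lemma signAvg_const_mul {n : ℕ} (c : ℝ) (F : (Fin n → ℝ) → ℝ) :
    signAvg n (fun s => c * F s) = c * signAvg n F := by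
  induction n with
  | zero => rfl
  | succ n ih => simp only [signAvg, ih]; ring

lemma signAvg_neg {n : ℕ} (F : (Fin n → ℝ) → ℝ) :
    signAvg n (fun s => F (fun i => -s i)) = signAvg n F := by
  induction n with
  | zero => exact congrArg F (Subsingleton.elim _ _)
  | succ n ih =>
    have key : ∀ (a : ℝ) (s : Fin n → ℝ),
        (fun i => -(Fin.cons a s : Fin (n + 1) → ℝ) i) = Fin.cons (-a) (fun i => -s i) := by
      intro a s
      ext i
      refine Fin.cases (by simp) (fun i => by simp) i
    simp only [signAvg, key, neg_neg]
    rw [ih (fun s => F (Fin.cons (-1) s)), ih (fun s => F (Fin.cons 1 s)), add_comm]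

lemma signAvg_list_sum {α : Type*} {n : ℕ} (l : List α) (F : α → (Fin n → ℝ) → ℝ) :
    signAvg n (fun s => (l.map fun a => F a s).sum) = (l.map fun a => signAvg n (F a)).sum := by
  induction l with
  | nil => simp [signAvg_const]
  | cons a l ih => simp only [List.map_cons, List.sum_cons, signAvg_add, ih]

lemma sq_signAvg_le {n : ℕ} (F : (Fin n → ℝ) → ℝ) :
    signAvg n F ^ 2 ≤ signAvg n (fun s => F s ^ 2) := by
  induction n with
  | zero => exact le_rfl
  | succ n ih =>
    have h1 := ih (fun s => F (Fin.cons 1 s))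
    have h2 := ih (fun s => F (Fin.cons (-1) s))
    simp only [signAvg]
    nlinarith [sq_nonneg (signAvg n (fun s => F (Fin.cons 1 s)) -
      signAvg n (fun s => F (Fin.cons (-1) s)))]

lemma exp_signAvg_le {n : ℕ} (F : (Fin n → ℝ) → ℝ) :
    Real.exp (signAvg n F) ≤ signAvg n (fun s => Real.exp (F s)) := by
  induction n with
  | zero => exact le_rfl
  | succ n ih =>
    have h1 := ih (fun s => F (Fin.cons 1 s))
    have h2 := ih (fun s => F (Fin.cons (-1) s))
    simp only [signAvg]
    set a := signAvg n (fun s => F (Fin.cons 1 s))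
    set b := signAvg n (fun s => F (Fin.cons (-1) s))
    have h := convexOn_exp.2 (Set.mem_univ a) (Set.mem_univ b)
      (by norm_num : (0 : ℝ) ≤ 1 / 2) (by norm_num : (0 : ℝ) ≤ 1 / 2) (by norm_num)
    simp only [smul_eq_mul] at h
    rw [show (a + b) / 2 = 1 / 2 * a + 1 / 2 * b by ring]
    linarith

lemma integrable_signAvg {Ω : Type*} [MeasurableSpace Ω] {μ : Measure Ω} {n : ℕ}
    {F : Ω → (Fin n → ℝ) → ℝ} (hF : ∀ s, IsSignVector s → Integrable (fun ω => F ω s) μ) :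
    Integrable (fun ω => signAvg n (F ω)) μ := by
  induction n with
  | zero => exact hF _ (fun i => i.elim0)
  | succ n ih =>
    simp only [signAvg]
    exact ((ih fun s hs => hF _ hs.cons_one).add (ih fun s hs => hF _ hs.cons_neg_one)).div_const 2

lemma integral_signAvg {Ω : Type*} [MeasurableSpace Ω] {μ : Measure Ω} {n : ℕ}
    {F : Ω → (Fin n → ℝ) → ℝ} (hF : ∀ s, IsSignVector s → Integrable (fun ω => F ω s) μ) :
    ∫ ω, signAvg n (F ω) ∂μ = signAvg n (fun s => ∫ ω, F ω s ∂μ) := by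
  induction n with
  | zero => rfl
  | succ n ih =>
    simp only [signAvg]
    rw [integral_div, integral_add (integrable_signAvg fun s hs => hF _ hs.cons_one)
      (integrable_signAvg fun s hs => hF _ hs.cons_neg_one), ih fun s hs => hF _ hs.cons_one,
      ih fun s hs => hF _ hs.cons_neg_one]

/-- Independent signs are orthogonal, so cross terms cancel. The constant `c` absorbs the
coordinates already fixed in the induction. -/
lemma signAvg_sq_linear {n : ℕ} (c : ℝ) (v : Fin n → ℝ) :
    signAvg n (fun s => (c + ∑ i, s i * v i) ^ 2) = c ^ 2 + ∑ i, v i ^ 2 := by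
  induction n generalizing c with
  | zero => simp [signAvg]
  | succ n ih =>
    simp only [signAvg, Fin.sum_univ_succ, Fin.cons_zero, Fin.cons_succ, ← add_assoc]
    rw [ih, ih]; ring

/-- Each sign contributes a factor `cosh (v i) ≤ exp (v i ^ 2 / 2)`. -/
lemma signAvg_exp_linear_le {n : ℕ} (c : ℝ) (v : Fin n → ℝ) :
    signAvg n (fun s => Real.exp (c + ∑ i, s i * v i)) ≤
      Real.exp (c + (∑ i, v i ^ 2) / 2) := by
  induction n generalizing c with
  | zero => simp [signAvg]
  | succ n ih =>
    simp only [signAvg, Fin.sum_univ_succ, Fin.cons_zero, Fin.cons_succ, ← add_assoc]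
    have h1 := ih (c + 1 * v 0) (fun i => v i.succ)
    have h2 := ih (c + -1 * v 0) (fun i => v i.succ)
    have h3 := Real.cosh_le_exp_half_sq (v 0)
    rw [Real.cosh_eq] at h3
    set S := ∑ i : Fin n, v i.succ ^ 2
    have e1 : Real.exp (c + 1 * v 0 + S / 2) = Real.exp (c + S / 2) * Real.exp (v 0) := by
      rw [← Real.exp_add]; ring_nf
    have e2 : Real.exp (c + -1 * v 0 + S / 2) = Real.exp (c + S / 2) * Real.exp (-v 0) := by
      rw [← Real.exp_add]; ring_nf
    have e3 : Real.exp (c + (v 0 ^ 2 + S) / 2)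
        = Real.exp (c + S / 2) * Real.exp (v 0 ^ 2 / 2) := by
      rw [← Real.exp_add]; ring_nf
    rw [e1] at h1
    rw [e2] at h2
    rw [e3]
    have := mul_le_mul_of_nonneg_left h3 (Real.exp_pos (c + S / 2)).le
    nlinarith

/-! ### Contraction -/

/-- The one-coordinate case of contraction. With maximizers `a`, `b` on the left, `ψ (t a) - ψ (t b)
≤ |t a - t b|`; the sign of `t a - t b` decides which of the two indices to test in which supremum
on the right. -/
lemma iSup_add_iSup_sub_le {ι : Type*} [Finite ι] [Nonempty ι] (u t : ι → ℝ) {ψ : ℝ → ℝ}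
    (hψ : LipschitzWith 1 ψ) :
    (⨆ j, (u j + ψ (t j))) + ⨆ j, (u j - ψ (t j)) ≤ (⨆ j, (u j + t j)) + ⨆ j, (u j - t j) := by
  obtain ⟨a, ha⟩ := exists_eq_ciSup_of_finite (f := fun j => u j + ψ (t j))
  obtain ⟨b, hb⟩ := exists_eq_ciSup_of_finite (f := fun j => u j - ψ (t j))
  rw [← ha, ← hb]
  have p := fun j => le_ciSup (Set.finite_range fun j => u j + t j).bddAbove j
  have m := fun j => le_ciSup (Set.finite_range fun j => u j - t j).bddAbove j
  have hl : |ψ (t a) - ψ (t b)| ≤ |t a - t b| := by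
    simpa [Real.dist_eq] using hψ.dist_le_mul (t a) (t b)
  have h1 := le_of_abs_le hl
  have pa := p a
  have pb := p b
  have ma := m a
  have mb := m b
  rcases abs_cases (t a - t b) with h | h <;> linarith

/-- The contraction principle for averages over signs of maxima of finite families. -/
lemma signAvg_contraction {ι : Type*} [Finite ι] [Nonempty ι] {n : ℕ} (c : ι → ℝ)
    (v : ι → Fin n → ℝ) {ψ : Fin n → ℝ → ℝ} (hψ : ∀ i, LipschitzWith 1 (ψ i)) :
    signAvg n (fun s => ⨆ j, (c j + ∑ i, s i * ψ i (v j i))) ≤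
      signAvg n (fun s => ⨆ j, (c j + ∑ i, s i * v j i)) := by
  induction n generalizing c with
  | zero => simp [signAvg]
  | succ n ih =>
    simp only [signAvg, Fin.sum_univ_succ, Fin.cons_zero, Fin.cons_succ, ← add_assoc]
    -- Once the first sign is fixed, its term joins the offset `c`; `ψ 0` is then removed by pairing
    -- the two values of that sign.
    have h1 := ih (fun j => c j + 1 * ψ 0 (v j 0)) (fun j i => v j i.succ) (fun i => hψ i.succ)
    have h2 := ih (fun j => c j + -1 * ψ 0 (v j 0)) (fun j i => v j i.succ) (fun i => hψ i.succ)
    refine div_le_div_of_nonneg_right ((add_le_add h1 h2).trans ?_) zero_le_two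
    rw [← signAvg_add, ← signAvg_add]
    refine signAvg_mono fun s _ => ?_
    have := iSup_add_iSup_sub_le (fun j => c j + ∑ i, s i * v j i.succ) (fun j => v j 0) (hψ 0)
    convert this using 4 <;> ring

/-! ### Monomials and Rademacher complexity of weighted trees -/

namespace LabeledTree

variable {p q : ℕ}

/-- The products of leaf functions that occur when a tree is expanded as a polynomial in its leaf
weights. -/
def monomials (φ : ℕ → ℝ → ℝ) : LabeledTree p q → List ((Fin p → ℝ) → ℝ)
  | leaf i j => [fun x => φ i (x j)]
  | node .add l r => l.monomials φ ++ r.monomials φ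
  | node .mul l r => (l.monomials φ ×ˢ r.monomials φ).map fun a => a.1 * a.2

lemma numLeaves_pos (f : LabeledTree p q) : 1 ≤ f.numLeaves := by
  induction f with
  | leaf i j => exact le_rfl
  | node op l r hl hr => simp only [numLeaves]; omega

lemma numNodes_add_one (f : LabeledTree p q) : f.numNodes + 1 = 2 * f.numLeaves := by
  induction f with
  | leaf i j => rfl
  | node op l r hl hr => simp only [numLeaves, numNodes]; omega

lemma abs_le_one_of_mem_monomials {φ : ℕ → ℝ → ℝ} (hφ : ∀ l t, φ l t ∈ Set.Icc (-1 : ℝ) 1)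
    (f : LabeledTree p q) {m : (Fin p → ℝ) → ℝ} (hm : m ∈ f.monomials φ) (x : Fin p → ℝ) :
    |m x| ≤ 1 := by
  induction f generalizing m with
  | leaf i j =>
    simp only [monomials, List.mem_singleton] at hm
    rw [hm]
    exact abs_le.2 (hφ _ _)
  | node op l r hl hr =>
    cases op with
    | add =>
      simp only [monomials, List.mem_append] at hm
      exact hm.elim hl hr
    | mul =>
      obtain ⟨⟨a, b⟩, hab, rfl⟩ := List.mem_map.1 hm
      obtain ⟨ha, hb⟩ := List.pair_mem_product.1 hab
      rw [Pi.mul_apply, abs_mul]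
      exact mul_le_one₀ (hl ha) (abs_nonneg _) (hr hb)

lemma length_monomials_pos (φ : ℕ → ℝ → ℝ) (f : LabeledTree p q) :
    1 ≤ (f.monomials φ).length := by
  induction f with
  | leaf i j => simp [monomials]
  | node op l r hl hr =>
    cases op with
    | add => simp only [monomials, List.length_append]; omega
    | mul =>
      simp only [monomials, List.length_map, List.length_product]
      exact Nat.mul_pos hl hr

/-- Products multiply the counts, and so dominate sums unless one summand has a single monomial. The
base `3` is the classical optimum for maximizing a product with given sum, attained by products of
sums of three leaves; cubing keeps the bound in `ℕ`. -/
lemma length_monomials_pow_three_le (φ : ℕ → ℝ → ℝ) (f : LabeledTree p q) :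
    (f.monomials φ).length ^ 3 ≤ 3 ^ f.numLeaves := by
  have add_le : ∀ {a b N M : ℕ}, 1 ≤ a → 1 ≤ b → 1 ≤ N → 1 ≤ M → N ^ 3 ≤ 3 ^ a → M ^ 3 ≤ 3 ^ b →
      (N = 1 → (N + M) ^ 3 ≤ 3 ^ (a + b)) := by
    rintro a b N M ha hb - hM - hMb rfl
    have h3a : 3 ≤ 3 ^ a := by simpa using Nat.pow_le_pow_right (by norm_num : 0 < 3) ha
    rw [pow_add]
    -- For `M = 1, 2` the cubes are `8 ≤ 9` and `27 = 3 * 9`, the latter using `2 ≤ b`; from `M = 3`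
    -- on, `(1 + M) ^ 3 ≤ 3 * M ^ 3`.
    rcases (by omega : M = 1 ∨ M = 2 ∨ 3 ≤ M) with rfl | rfl | h
    · have : 3 ≤ 3 ^ b := by simpa using Nat.pow_le_pow_right (by norm_num : 0 < 3) hb
      nlinarith
    · have : 2 ≤ b := by
        by_contra hlt
        have : b = 1 := by omega
        subst this
        norm_num at hMb
      have : 9 ≤ 3 ^ b := by simpa using Nat.pow_le_pow_right (by norm_num : 0 < 3) this
      nlinarith
    · have : (1 + M) ^ 3 ≤ 3 * M ^ 3 := by
        obtain ⟨c, rfl⟩ := Nat.exists_eq_add_of_le h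
        ring_nf
        nlinarith [Nat.zero_le (c ^ 3), Nat.zero_le (c ^ 2)]
      exact this.trans (Nat.mul_le_mul h3a hMb)
  induction f with
  | leaf i j => simp [monomials, numLeaves]
  | node op l r hl hr =>
    cases op with
    | add =>
      have hN := l.length_monomials_pos φ
      have hM := r.length_monomials_pos φ
      have ha := l.numLeaves_pos
      have hb := r.numLeaves_pos
      simp only [monomials, List.length_append, numLeaves]
      set N := (l.monomials φ).length
      set M := (r.monomials φ).length
      by_cases h1 : N = 1
      · exact add_le ha hb hN hM hl hr h1
      by_cases h2 : M = 1
      · rw [add_comm N, add_comm l.numLeaves]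
        exact add_le hb ha hM hN hr hl h2
      have : N + M ≤ N * M := by
        have : 2 ≤ N := by omega
        have : 2 ≤ M := by omega
        nlinarith
      calc (N + M) ^ 3 ≤ (N * M) ^ 3 := Nat.pow_le_pow_left this 3
        _ = N ^ 3 * M ^ 3 := mul_pow ..
        _ ≤ _ := by rw [pow_add]; exact Nat.mul_le_mul hl hr
    | mul =>
      simp only [monomials, List.length_map, List.length_product, numLeaves]
      rw [mul_pow, pow_add]
      exact Nat.mul_le_mul hl hr

/-- A tree has at most as many monomials as leaves, or few enough for a bound on exponential
moments. -/
lemma length_monomials_le_or (φ : ℕ → ℝ → ℝ) (f : LabeledTree p q) :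
    (f.monomials φ).length ≤ f.numLeaves ∨
      2 * ((f.monomials φ).length : ℝ) ≤ Real.exp (f.numLeaves / 2) := by
  have h := f.length_monomials_pow_three_le φ
  have hpos := f.numLeaves_pos
  set N := (f.monomials φ).length
  set m := f.numLeaves
  have he : (2.7182818283 : ℝ) ≤ Real.exp 1 := Real.exp_one_gt_d9.le
  by_cases h4 : m ≤ 4
  · left
    interval_cases m
    all_goals
      by_contra hlt
      push Not at hlt
      have := Nat.pow_le_pow_left (Nat.succ_le_of_lt hlt) 3
      norm_num at this h
      omega
  right
  have hexp : Real.exp ((m : ℝ) / 2) ^ 2 = Real.exp 1 ^ m := by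
    rw [← Real.exp_nat_mul, ← Real.exp_nat_mul]; congr 1; push_cast; ring
  -- Here `N ^ 3 ≤ 243` forces `N ≤ 6`, and `12 ≤ exp (5 / 2)` holds narrowly. For `m ≥ 6` sixth
  -- powers are compared, through `64 * 9 ^ m ≤ 20 ^ m` and `20 ≤ exp 3`.
  by_cases h5 : m = 5
  · have hN : N ≤ 6 := by
      by_contra hlt
      push Not at hlt
      have := Nat.pow_le_pow_left (Nat.succ_le_of_lt hlt) 3
      rw [h5] at h
      norm_num at this h
      omega
    have hN' : (N : ℝ) ≤ 6 := by exact_mod_cast hN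
    rw [h5] at hexp ⊢
    have he5 := pow_le_pow_left₀ (by norm_num) he 5
    refine (pow_le_pow_iff_left₀ (by positivity) (Real.exp_pos _).le two_ne_zero).1 ?_
    rw [hexp]
    refine le_trans ?_ he5
    have : (2 * (N : ℝ)) ^ 2 ≤ (2 * 6) ^ 2 := pow_le_pow_left₀ (by positivity) (by linarith) 2
    refine this.trans ?_
    norm_num
  · obtain ⟨c, hc⟩ := Nat.exists_eq_add_of_le (by omega : 6 ≤ m)
    have h' : (N : ℝ) ^ 3 ≤ 3 ^ m := by exact_mod_cast h
    refine (pow_le_pow_iff_left₀ (by positivity) (Real.exp_pos _).le (by norm_num : 6 ≠ 0)).1 ?_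
    have h20 : (20 : ℝ) ≤ Real.exp 1 ^ 3 :=
      le_trans (by norm_num) (pow_le_pow_left₀ (by norm_num) he 3)
    calc (2 * (N : ℝ)) ^ 6 = 64 * ((N : ℝ) ^ 3) ^ 2 := by ring
      _ ≤ 64 * (3 ^ m) ^ 2 := by gcongr
      _ = 64 * 9 ^ 6 * 9 ^ c := by rw [← pow_mul, mul_comm m 2, pow_mul, hc, pow_add]; norm_num; ring
      _ ≤ 20 ^ 6 * 20 ^ c := by gcongr <;> norm_num
      _ = 20 ^ m := by rw [hc, pow_add]
      _ ≤ (Real.exp 1 ^ 3) ^ m := by gcongr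
      _ = Real.exp (m / 2) ^ 6 := by
        rw [← pow_mul, mul_comm 3 m, pow_mul, ← hexp]; ring

/-- A linear functional that is bounded on the monomials of a tree is bounded on the weighted trees
whose weights are summable to at most one. -/
lemma abs_apply_eval_le (φ : ℕ → ℝ → ℝ) (f : LabeledTree p q)
    (L : ((Fin p → ℝ) → ℝ) →ₗ[ℝ] ℝ) {B : ℝ} (hB : 0 ≤ B) (hL : ∀ m ∈ f.monomials φ, |L m| ≤ B)
    (w : Fin f.numLeaves → ℝ) (hw : ∑ a, |w a| ≤ 1) :
    |L fun x => f.eval φ x w| ≤ B * ∑ a, |w a| := by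
  induction f generalizing L B with
  | leaf i j =>
    have h := hL _ (List.mem_singleton.2 rfl)
    have hs : ∑ a, |w a| = |w (0 : Fin 1)| := Fin.sum_univ_one (fun a => |w a|)
    have he : (fun x => (leaf i j : LabeledTree p q).eval φ x w)
        = w (0 : Fin 1) • fun x : Fin p → ℝ => φ i (x j) := rfl
    rw [he, hs, map_smul, smul_eq_mul, abs_mul, mul_comm]
    exact mul_le_mul_of_nonneg_right h (abs_nonneg _)
  | node op l r hl hr =>
    set wl : Fin l.numLeaves → ℝ := fun a => w (Fin.castAdd r.numLeaves a) with hwl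
    set wr : Fin r.numLeaves → ℝ := fun a => w (Fin.natAdd l.numLeaves a) with hwr
    have hsum : ∑ a, |w a| = ∑ a, |wl a| + ∑ a, |wr a| := Fin.sum_univ_add (fun a => |w a|)
    have hl0 : 0 ≤ ∑ a, |wl a| := Finset.sum_nonneg fun _ _ => abs_nonneg _
    have hr0 : 0 ≤ ∑ a, |wr a| := Finset.sum_nonneg fun _ _ => abs_nonneg _
    rw [hsum] at hw ⊢
    cases op with
    | add =>
      have he : (fun x => (node .add l r).eval φ x w)
          = (fun x => l.eval φ x wl) + fun x => r.eval φ x wr := rfl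
      have h1 := hl L hB (fun m hm => hL m (List.mem_append_left _ hm)) wl (by linarith)
      have h2 := hr L hB (fun m hm => hL m (List.mem_append_right _ hm)) wr (by linarith)
      rw [he, map_add, mul_add]
      exact (abs_add_le _ _).trans (add_le_add h1 h2)
    | mul =>
      have he : (fun x => (node .mul l r).eval φ x w)
          = (fun x => l.eval φ x wl) * fun x => r.eval φ x wr := rfl
      -- Fixing one factor makes `L` linear in the other: the right factor is treated with a
      -- monomial on the left, then the left factor with the new bound `B * ∑ a, |wr a|`.
      have h1 : ∀ m ∈ l.monomials φ, |L (m * fun x => r.eval φ x wr)| ≤ B * ∑ a, |wr a| := by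
        intro m hm
        refine hr (L ∘ₗ LinearMap.mulLeft ℝ m) hB (fun m' hm' => ?_) wr (by linarith)
        exact hL _ (List.mem_map.2 ⟨(m, m'), List.pair_mem_product.2 ⟨hm, hm'⟩, rfl⟩)
      have h2 := hl (L ∘ₗ LinearMap.mulRight ℝ fun x => r.eval φ x wr) (mul_nonneg hB hr0) h1 wl
        (by linarith)
      rw [he]
      refine h2.trans ?_
      rw [mul_assoc]
      refine mul_le_mul_of_nonneg_left ?_ hB
      -- The product of two nonnegative numbers with sum at most one is at most their sum.
      nlinarith


/-- The empirical Rademacher complexity of the weighted trees with `m` leaves is at most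
`√(m / n)`, here multiplied by `n`. -/
lemma signAvg_iSup_eval_le {φ : ℕ → ℝ → ℝ} (hφ : ∀ l t, φ l t ∈ Set.Icc (-1 : ℝ) 1)
    (f : LabeledTree p q) {n : ℕ} (hn : 1 ≤ n) (x : Fin n → Fin p → ℝ) {ι : Type*} [Finite ι]
    [Nonempty ι] (w : ι → Fin f.numLeaves → ℝ) (hw : ∀ j, ∑ a, |w j a| ≤ 1) :
    signAvg n (fun s => ⨆ j, ∑ i, s i * f.eval φ (x i) (w j)) ≤
      Real.sqrt (f.numLeaves * n) := by
  set l := f.monomials φ with hl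
  set m : ℝ := (f.numLeaves : ℝ) with hm
  have hm0 : 0 < m := Nat.cast_pos.2 f.numLeaves_pos
  have hn0 : (0 : ℝ) < n := by exact_mod_cast hn
  let L : (Fin n → ℝ) → ((Fin p → ℝ) → ℝ) →ₗ[ℝ] ℝ := fun s =>
    { toFun := fun g => ∑ i, s i * g (x i)
      map_add' := fun g g' => by simp [mul_add, Finset.sum_add_distrib]
      map_smul' := fun c g => by
        simp only [Pi.smul_apply, smul_eq_mul, RingHom.id_apply, Finset.mul_sum]
        exact Finset.sum_congr rfl fun i _ => by ring }
  have hLap : ∀ s g, L s g = ∑ i, s i * g (x i) := fun _ _ => rfl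
  have hsq : ∀ g ∈ l, ∑ i, g (x i) ^ 2 ≤ n := by
    intro g hg
    calc ∑ i, g (x i) ^ 2 ≤ ∑ _i : Fin n, (1 : ℝ) := Finset.sum_le_sum fun i _ => by
          rw [sq_le_one_iff_abs_le_one]; exact f.abs_le_one_of_mem_monomials hφ hg _
      _ = n := by simp
  have hsup : ∀ s B, 0 ≤ B → (∀ g ∈ l, |L s g| ≤ B) →
      ⨆ j, ∑ i, s i * f.eval φ (x i) (w j) ≤ B := by
    intro s B hB h
    refine ciSup_le fun j => ?_
    have := abs_apply_eval_le φ f (L s) hB h (w j) (hw j)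
    exact (le_of_abs_le this).trans (mul_le_of_le_one_right hB (hw j))
  rcases f.length_monomials_le_or φ with hN | hN
  · have hN' : (l.length : ℝ) ≤ m := Nat.cast_le.2 hN
    have hnn : ∀ s, 0 ≤ (l.map fun g => L s g ^ 2).sum := fun s =>
      List.sum_nonneg fun a ha => by
        obtain ⟨g, -, rfl⟩ := List.mem_map.1 ha
        positivity
    -- The maximum over monomials is replaced by the Euclidean norm, whose mean square is at most `N
    -- * n`.
    have h1 : signAvg n (fun s => ⨆ j, ∑ i, s i * f.eval φ (x i) (w j)) ≤
        signAvg n (fun s => Real.sqrt ((l.map fun g => L s g ^ 2).sum)) := by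
      refine signAvg_mono fun s _ => hsup s _ (Real.sqrt_nonneg _) fun g hg => ?_
      refine Real.abs_le_sqrt (List.single_le_sum (fun a ha => ?_) _ (List.mem_map_of_mem hg))
      obtain ⟨g, -, rfl⟩ := List.mem_map.1 ha
      positivity
    refine h1.trans (Real.le_sqrt_of_sq_le ((sq_signAvg_le _).trans ?_))
    simp only [Real.sq_sqrt (hnn _)]
    rw [signAvg_list_sum l fun g s => L s g ^ 2]
    have h2 : ∀ g ∈ l, signAvg n (fun s => L s g ^ 2) ≤ n := by
      intro g hg
      have := signAvg_sq_linear 0 fun i => g (x i)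
      simp only [zero_add, ne_eq, OfNat.ofNat_ne_zero, not_false_eq_true, zero_pow] at this
      simp only [hLap, this]
      exact hsq g hg
    calc (l.map fun g => signAvg n fun s => L s g ^ 2).sum
        ≤ (l.map fun _ => (n : ℝ)).sum := List.sum_le_sum h2
      _ = l.length * n := by simp
      _ ≤ m * n := by gcongr
  -- This `t` makes each exponential moment at most `exp (m / 2)`; with `2 N ≤ exp (m / 2)` this
  -- gives `t * A ≤ m`, and `m / t = √(m * n)`.
  · set t : ℝ := Real.sqrt (m / n) with ht
    have ht0 : 0 < t := Real.sqrt_pos.2 (div_pos hm0 hn0)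
    have htsq : t ^ 2 = m / n := Real.sq_sqrt (div_pos hm0 hn0).le
    set A := signAvg n (fun s => ⨆ j, ∑ i, s i * f.eval φ (x i) (w j)) with hA
    have hE : Real.exp (t * A) ≤ Real.exp m := by
      rw [hA, ← signAvg_const_mul]
      refine (exp_signAvg_le _).trans ?_
      have h1 : ∀ s, Real.exp (t * ⨆ j, ∑ i, s i * f.eval φ (x i) (w j)) ≤
          (l.map fun g => Real.exp (t * L s g) + Real.exp (-t * L s g)).sum := by
        intro s
        set T := (l.map fun g => Real.exp (t * L s g) + Real.exp (-t * L s g)).sum with hT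
        have habs : ∀ g ∈ l, Real.exp (t * |L s g|) ≤ T := by
          intro g hg
          have h2 : Real.exp (t * |L s g|) ≤ Real.exp (t * L s g) + Real.exp (-t * L s g) := by
            rcases abs_choice (L s g) with h | h <;> rw [h]
            · linarith [Real.exp_pos (-t * L s g)]
            · rw [mul_neg, ← neg_mul]; linarith [Real.exp_pos (t * L s g)]
          refine h2.trans (List.single_le_sum (fun a ha => ?_) _ (List.mem_map_of_mem hg))
          obtain ⟨g, -, rfl⟩ := List.mem_map.1 ha
          positivity
        -- One monomial already gives `1 ≤ T`, so that `log T / t` is an admissible nonnegative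
        -- bound.
        obtain ⟨g0, hg0⟩ := List.exists_mem_of_length_pos (f.length_monomials_pos φ)
        have hT1 : 1 ≤ T :=
          (Real.one_le_exp (mul_nonneg ht0.le (abs_nonneg _))).trans (habs g0 hg0)
        have h3 := hsup s (Real.log T / t) (div_nonneg (Real.log_nonneg hT1) ht0.le)
          fun g hg => by
            rw [le_div_iff₀ ht0, mul_comm]
            exact (Real.le_log_iff_exp_le (by linarith)).2 (habs g hg)
        rw [le_div_iff₀ ht0, mul_comm] at h3
        exact (Real.le_log_iff_exp_le (by linarith)).1 h3
      refine (signAvg_mono fun s _ => h1 s).trans ?_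
      rw [signAvg_list_sum l fun g s => Real.exp (t * L s g) + Real.exp (-t * L s g)]
      have h4 : ∀ (u : ℝ), u ^ 2 = m / n → ∀ g ∈ l,
          signAvg n (fun s => Real.exp (u * L s g)) ≤ Real.exp (m / 2) := by
        intro u hu g hg
        have h5 := signAvg_exp_linear_le 0 fun i => u * g (x i)
        have h6 : ∀ s, u * L s g = 0 + ∑ i, s i * (u * g (x i)) := by
          intro s
          rw [hLap, Finset.mul_sum, zero_add]
          exact Finset.sum_congr rfl fun i _ => by ring
        simp only [h6]
        refine h5.trans (Real.exp_le_exp.2 ?_)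
        simp only [mul_pow, ← Finset.mul_sum, hu]
        have : m / n * ∑ i, g (x i) ^ 2 ≤ m / n * n :=
          mul_le_mul_of_nonneg_left (hsq g hg) (div_pos hm0 hn0).le
        rw [div_mul_cancel₀ _ hn0.ne'] at this
        linarith
      calc _ ≤ (l.map fun _ => 2 * Real.exp (m / 2)).sum := by
            refine List.sum_le_sum fun g hg => ?_
            rw [signAvg_add]
            have := h4 t htsq g hg
            have := h4 (-t) (by rw [neg_sq, htsq]) g hg
            linarith
        _ = (2 * l.length) * Real.exp (m / 2) := by
            simp only [List.map_const', List.sum_replicate, nsmul_eq_mul]; ring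
        _ ≤ Real.exp (m / 2) * Real.exp (m / 2) := by gcongr
        _ = Real.exp m := by rw [← Real.exp_add, add_halves]
    have hle := Real.exp_le_exp.1 hE
    refine le_of_mul_le_mul_left (hle.trans_eq ?_) ht0
    rw [ht, ← Real.sqrt_mul (div_pos hm0 hn0).le,
      show m / n * (m * n) = m ^ 2 by field_simp, Real.sqrt_sq hm0.le]

end LabeledTree

/-! ### Bounded differences -/

section Concentration

variable {Z : Type*} [MeasurableSpace Z] {D : Measure Z} [IsProbabilityMeasure D]

lemma integrable_of_abs_le {Ω : Type*} [MeasurableSpace Ω] {μ : Measure Ω} [IsFiniteMeasure μ]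
    {F : Ω → ℝ} (hF : Measurable F) {C : ℝ} (hC : ∀ ω, |F ω| ≤ C) : Integrable F μ :=
  Integrable.of_bound hF.aestronglyMeasurable C (ae_of_all _ hC)

lemma measurable_fin_cons {n : ℕ} :
    Measurable fun a : Z × (Fin n → Z) => (Fin.cons a.1 a.2 : Fin (n + 1) → Z) := by
  refine measurable_pi_iff.2 fun i => ?_
  refine Fin.cases ?_ (fun i => ?_) i
  · simpa using measurable_fst
  · simpa using measurable_snd.eval

lemma integral_pi_succ {n : ℕ} {G : (Fin (n + 1) → Z) → ℝ} (hG : Measurable G) {C : ℝ}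
    (hC : ∀ S, |G S| ≤ C) :
    ∫ S, G S ∂Measure.pi (fun _ => D) =
      ∫ z, ∫ S, G (Fin.cons z S) ∂Measure.pi (fun _ => D) ∂D := by
  have h := (measurePreserving_piFinSuccAbove (fun _ : Fin (n + 1) => D) 0).symm
  rw [← h.integral_comp']
  have he : ∀ a : Z × (Fin n → Z),
      (MeasurableEquiv.piFinSuccAbove (fun _ : Fin (n + 1) => Z) 0).symm a = Fin.cons a.1 a.2 :=
    fun a => Fin.insertNth_zero' _ _
  simp only [he]
  exact integral_prod _ (integrable_of_abs_le (hG.comp measurable_fin_cons) fun _ => hC _)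

/-- Hoeffding's lemma, applied on the interval of length `c` starting at the infimum of `G`. -/
lemma integral_exp_le_of_oscillation_le {G : Z → ℝ} (hG : Measurable G) {C : ℝ}
    (hC : ∀ z, |G z| ≤ C) {c : ℝ} (hc : 0 ≤ c) (hd : ∀ z z', |G z' - G z| ≤ c) (t : ℝ) :
    ∫ z, Real.exp (t * G z) ∂D ≤ Real.exp (t * ∫ z, G z ∂D + c ^ 2 * t ^ 2 / 8) := by
  have : Nonempty Z := D.nonempty_of_neZero
  have hbdd : BddBelow (Set.range G) := ⟨-C, by rintro _ ⟨z, rfl⟩; exact (abs_le.1 (hC z)).1⟩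
  have hIcc : ∀ z, G z ∈ Set.Icc (⨅ z, G z) ((⨅ z, G z) + c) := by
    refine fun z => ⟨ciInf_le hbdd z, ?_⟩
    have : G z - c ≤ ⨅ z, G z := le_ciInf fun z' => by
      have := le_of_abs_le (hd z' z)
      linarith
    linarith
  have h := (hasSubgaussianMGF_of_mem_Icc hG.aemeasurable (ae_of_all D hIcc)).mgf_le t
  simp only [mgf, mul_sub, Real.exp_sub, integral_div] at h
  rw [div_le_iff₀ (Real.exp_pos _), ← Real.exp_add] at h
  refine h.trans (Real.exp_le_exp.2 (le_of_eq ?_))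
  simp only [add_sub_cancel_left, NNReal.coe_pow, NNReal.coe_div, coe_nnnorm, Real.norm_eq_abs,
    abs_of_nonneg hc, NNReal.coe_ofNat]
  ring

/-- The bound on exponential moments behind McDiarmid's inequality. -/
lemma integral_exp_le_of_boundedDifferences {n : ℕ} {F : (Fin n → Z) → ℝ} (hF : Measurable F)
    {C : ℝ} (hC : ∀ S, |F S| ≤ C) {c : ℝ} (hc : 0 ≤ c)
    (hd : ∀ S i z, |F (Function.update S i z) - F S| ≤ c) (t : ℝ) :
    ∫ S, Real.exp (t * F S) ∂Measure.pi (fun _ => D) ≤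
      Real.exp (t * ∫ S, F S ∂Measure.pi (fun _ => D) + n * (c ^ 2 * t ^ 2 / 8)) := by
  induction n with
  | zero =>
    have h : ∀ S, F S = F Fin.elim0 := fun S => congrArg F (Subsingleton.elim _ _)
    simp [h]
  | succ n ih =>
    set ν : Measure (Fin n → Z) := Measure.pi fun _ => D with hν
    have hexpC : ∀ S, |Real.exp (t * F S)| ≤ Real.exp (|t| * C) := fun S => by
      rw [Real.abs_exp]
      refine Real.exp_le_exp.2 ((le_abs_self _).trans ?_)
      rw [abs_mul]
      exact mul_le_mul_of_nonneg_left (hC S) (abs_nonneg t)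
    have hexp : Measurable fun S => Real.exp (t * F S) := (hF.const_mul t).exp
    have hFz : ∀ z, Measurable fun S : Fin n → Z => F (Fin.cons z S) := fun z =>
      hF.comp (measurable_fin_cons.comp measurable_prodMk_left)
    -- The mean of `F` given the first sample. It inherits oscillation at most `c`, so Hoeffding's
    -- lemma handles it and the induction hypothesis handles the other samples.
    set G : Z → ℝ := fun z => ∫ S, F (Fin.cons z S) ∂ν with hG
    have hGm : Measurable G :=
      ((hF.comp measurable_fin_cons).stronglyMeasurable.integral_prod_right' (ν := ν)).measurable
    have hGC : ∀ z, |G z| ≤ C := fun z => by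
      have : ∀ S : Fin n → Z, ‖F (Fin.cons z S)‖ ≤ C := fun S => hC _
      simpa using norm_integral_le_of_norm_le_const (μ := ν) (ae_of_all _ this)
    have hGd : ∀ z z', |G z' - G z| ≤ c := fun z z' => by
      rw [hG, ← integral_sub (integrable_of_abs_le (hFz z') fun _ => hC _)
        (integrable_of_abs_le (hFz z) fun _ => hC _)]
      have : ∀ S : Fin n → Z, ‖F (Fin.cons z' S) - F (Fin.cons z S)‖ ≤ c := fun S => by
        have := hd (Fin.cons z S) 0 z'
        rwa [Fin.update_cons_zero] at this
      simpa using norm_integral_le_of_norm_le_const (μ := ν) (ae_of_all _ this)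
    rw [integral_pi_succ hexp hexpC, integral_pi_succ hF hC]
    have hstep : ∀ z, ∫ S, Real.exp (t * F (Fin.cons z S)) ∂ν ≤
        Real.exp (t * G z) * Real.exp (n * (c ^ 2 * t ^ 2 / 8)) := fun z => by
      rw [← Real.exp_add]
      refine ih (hFz z) (fun S => hC _) fun S i z' => ?_
      rw [Fin.cons_update]
      exact hd _ _ _
    have hexpG : ∀ z, |Real.exp (t * G z)| ≤ Real.exp (|t| * C) := fun z => by
      rw [Real.abs_exp]
      refine Real.exp_le_exp.2 ((le_abs_self _).trans ?_)
      rw [abs_mul]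
      exact mul_le_mul_of_nonneg_left (hGC z) (abs_nonneg t)
    have hL : Integrable (fun z => ∫ S, Real.exp (t * F (Fin.cons z S)) ∂ν) D :=
      (integrable_of_abs_le (μ := D.prod ν) (hexp.comp measurable_fin_cons)
        fun _ => hexpC _).integral_prod_left
    calc ∫ z, ∫ S, Real.exp (t * F (Fin.cons z S)) ∂ν ∂D
        ≤ ∫ z, Real.exp (t * G z) * Real.exp (n * (c ^ 2 * t ^ 2 / 8)) ∂D :=
          integral_mono hL ((integrable_of_abs_le (hGm.const_mul t).exp hexpG).mul_const _) hstep
      _ = (∫ z, Real.exp (t * G z) ∂D) * Real.exp (n * (c ^ 2 * t ^ 2 / 8)) :=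
          integral_mul_const _ _
      _ ≤ Real.exp (t * ∫ z, G z ∂D + c ^ 2 * t ^ 2 / 8) * Real.exp (n * (c ^ 2 * t ^ 2 / 8)) :=
          mul_le_mul_of_nonneg_right (integral_exp_le_of_oscillation_le hGm hGC hc hGd t)
            (Real.exp_pos _).le
      _ = _ := by rw [← Real.exp_add]; push_cast; simp only [hG, ← hν]; ring_nf

/-- McDiarmid's inequality for functions whose differences are bounded by one. -/
lemma measure_integral_add_le_of_boundedDifferences {n : ℕ} {F : (Fin n → Z) → ℝ}
    (hF : Measurable F) {C : ℝ} (hC : ∀ S, |F S| ≤ C)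
    (hd : ∀ S i z, |F (Function.update S i z) - F S| ≤ 1) {ε : ℝ} (hε : 0 ≤ ε) :
    (Measure.pi fun _ => D).real {S | ∫ S, F S ∂Measure.pi (fun _ => D) + n * ε ≤ F S} ≤
      Real.exp (-(2 * n * ε ^ 2)) := by
  -- The exponent `-t n ε + n t ^ 2 / 8` is smallest at `t = 4 ε`.
  have hexp : Integrable (fun S => Real.exp (4 * ε * F S)) (Measure.pi fun _ => D) := by
    refine integrable_of_abs_le (C := Real.exp (4 * ε * C)) (hF.const_mul _).exp fun S => ?_
    rw [Real.abs_exp]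
    exact Real.exp_le_exp.2 (mul_le_mul_of_nonneg_left (le_of_abs_le (hC S)) (by positivity))
  refine (measure_ge_le_exp_mul_mgf _ (by positivity : 0 ≤ 4 * ε) hexp).trans ?_
  refine (mul_le_mul_of_nonneg_left
    (integral_exp_le_of_boundedDifferences hF hC zero_le_one hd (4 * ε)) (Real.exp_pos _).le).trans ?_
  rw [← Real.exp_add]
  exact Real.exp_le_exp.2 (le_of_eq (by ring))

end Concentration

/-! ### Symmetrization -/

section Symmetrization

variable {Z : Type*} [MeasurableSpace Z] {D : Measure Z} [IsProbabilityMeasure D]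
  {ι : Type*} [Finite ι]

lemma abs_iSup_le_of_finite [Nonempty ι] {u : ι → ℝ} {C : ℝ} (hu : ∀ j, |u j| ≤ C) : |⨆ j, u j| ≤ C := by
  obtain ⟨j, hj⟩ := exists_eq_ciSup_of_finite (f := u)
  exact hj ▸ hu j

lemma abs_iSup_sub_iSup_le [Nonempty ι] {u v : ι → ℝ} {C : ℝ} (h : ∀ j, |u j - v j| ≤ C) :
    |(⨆ j, u j) - ⨆ j, v j| ≤ C := by
  have hu := fun j => le_ciSup (Set.finite_range u).bddAbove j
  have hv := fun j => le_ciSup (Set.finite_range v).bddAbove j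
  obtain ⟨a, ha⟩ := exists_eq_ciSup_of_finite (f := u)
  obtain ⟨b, hb⟩ := exists_eq_ciSup_of_finite (f := v)
  rw [abs_le]
  constructor
  · linarith [hu b, (abs_le.1 (h b)).1]
  · linarith [hv a, (abs_le.1 (h a)).2]

lemma abs_sum_le_card {n : ℕ} {u : Fin n → ℝ} (hu : ∀ i, |u i| ≤ 1) : |∑ i, u i| ≤ n := by
  refine (Finset.abs_sum_le_sum_abs _ _).trans ((Finset.sum_le_sum fun i _ => hu i).trans ?_)
  simp

lemma abs_integral_sub_le_one {h : Z → ℝ} (hm : Measurable h)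
    (hI : ∀ z, h z ∈ Set.Icc (0 : ℝ) 1) (z : Z) : |(∫ z, h z ∂D) - h z| ≤ 1 := by
  have hint : Integrable h D := integrable_of_abs_le hm (C := 1) fun z => by
    rw [abs_of_nonneg (hI z).1]; exact (hI z).2
  have h0 : 0 ≤ ∫ z, h z ∂D := integral_nonneg fun z => (hI z).1
  have h1 : ∫ z, h z ∂D ≤ 1 := by
    simpa using integral_mono hint (integrable_const 1) fun z => (hI z).2
  rw [abs_le]
  constructor <;> linarith [(hI z).1, (hI z).2]

/-- Swapping the two members of the pairs with sign `-1` preserves the product measure. -/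
lemma integral_iSup_sign_mul_sub {n : ℕ} (h : ι → Z → ℝ) (hm : ∀ j, Measurable (h j))
    {s : Fin n → ℝ} (hs : IsSignVector s) :
    ∫ T, ⨆ j, ∑ i, s i * (h j (T i).2 - h j (T i).1) ∂Measure.pi (fun _ => D.prod D) =
      ∫ T, ⨆ j, ∑ i, (h j (T i).2 - h j (T i).1) ∂Measure.pi (fun _ : Fin n => D.prod D) := by
  classical
  set g : Fin n → Z × Z → Z × Z := fun i a => if s i = 1 then a else a.swap with hg
  have hgm : MeasurePreserving (fun (T : Fin n → Z × Z) i => g i (T i))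
      (Measure.pi fun _ => D.prod D) (Measure.pi fun _ => D.prod D) := by
    refine measurePreserving_pi _ _ fun i => ?_
    by_cases h1 : s i = 1
    · simp only [hg, h1, if_true]
      exact MeasurePreserving.id _
    · simp only [hg, h1, if_false]
      exact Measure.measurePreserving_swap
  have hK : Measurable fun T : Fin n → Z × Z => ⨆ j, ∑ i, (h j (T i).2 - h j (T i).1) := by
    refine Measurable.iSup fun j => Finset.measurable_sum _ fun i _ => ?_
    exact ((hm j).comp (measurable_snd.comp (measurable_pi_apply i))).sub
      ((hm j).comp (measurable_fst.comp (measurable_pi_apply i)))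
  conv_rhs => rw [← hgm.map_eq]
  rw [integral_map hgm.measurable.aemeasurable hK.aestronglyMeasurable]
  congr 1 with T
  congr 1 with j
  refine Finset.sum_congr rfl fun i _ => ?_
  rcases hs i with h1 | h1
  · simp [hg, h1]
  · simp only [hg, h1]
    norm_num

/-- Symmetrization: the expected uniform deviation is at most twice the Rademacher complexity. -/
lemma integral_iSup_deviation_le [Nonempty ι] {n : ℕ} (h : ι → Z → ℝ) (hm : ∀ j, Measurable (h j))
    (hI : ∀ j z, h j z ∈ Set.Icc (0 : ℝ) 1) {R : ℝ}
    (hR : ∀ S : Fin n → Z, signAvg n (fun s => ⨆ j, ∑ i, s i * h j (S i)) ≤ R) :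
    ∫ S, ⨆ j, ∑ i, ((∫ z, h j z ∂D) - h j (S i)) ∂Measure.pi (fun _ : Fin n => D) ≤ 2 * R := by
  set μ : Measure (Fin n → Z) := Measure.pi fun _ => D with hμ
  set π : Measure (Fin n → Z × Z) := Measure.pi fun _ => D.prod D with hπ
  have habs : ∀ j z z', |h j z' - h j z| ≤ 1 := fun j z z' => by
    have h1 := hI j z
    have h2 := hI j z'
    rw [abs_le]
    constructor <;> linarith [h1.1, h1.2, h2.1, h2.2]
  have hint : ∀ j, Integrable (h j) D := fun j => integrable_of_abs_le (hm j) (C := 1) fun z => by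
    rw [abs_of_nonneg (hI j z).1]; exact (hI j z).2
  have hmi : ∀ j i, Measurable fun S : Fin n → Z => h j (S i) := fun j i =>
    (hm j).comp (measurable_pi_apply i)
  have hE : ∀ j i, ∫ S, h j (S i) ∂μ = ∫ z, h j z ∂D := fun j i => by
    have := measurePreserving_eval (fun _ : Fin n => D) i
    conv_rhs => rw [← this.map_eq]
    rw [integral_map this.measurable.aemeasurable (hm j).aestronglyMeasurable]
  have hK2 : Measurable fun a : (Fin n → Z) × (Fin n → Z) =>
      ⨆ j, ∑ i, (h j (a.2 i) - h j (a.1 i)) :=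
    Measurable.iSup fun j => Finset.measurable_sum _ fun i _ =>
      ((hmi j i).comp measurable_snd).sub ((hmi j i).comp measurable_fst)
  have hK2b : ∀ a : (Fin n → Z) × (Fin n → Z),
      |⨆ j, ∑ i, (h j (a.2 i) - h j (a.1 i))| ≤ n := fun a =>
    abs_iSup_le_of_finite fun j => abs_sum_le_card fun i => habs j _ _
  have hK2i : Integrable (fun a : (Fin n → Z) × (Fin n → Z) =>
      ⨆ j, ∑ i, (h j (a.2 i) - h j (a.1 i))) (μ.prod μ) := integrable_of_abs_le hK2 hK2b
  -- Each true mean is an average over a ghost sample `S'`, and a supremum of means is at most the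
  -- mean of the supremum.
  have step1 : ∫ S, ⨆ j, ∑ i, ((∫ z, h j z ∂D) - h j (S i)) ∂μ ≤
      ∫ S, ∫ S', ⨆ j, ∑ i, (h j (S' i) - h j (S i)) ∂μ ∂μ := by
    refine integral_mono ?_ hK2i.integral_prod_left fun S => ciSup_le fun j => ?_
    · exact integrable_of_abs_le (C := n) (Measurable.iSup fun j => Finset.measurable_sum _ fun i _ =>
        (hmi j i).const_sub _) fun S => abs_iSup_le_of_finite fun j =>
          abs_sum_le_card fun i => abs_integral_sub_le_one (hm j) (hI j) _
    · have hii : ∀ i, Integrable (fun S' : Fin n → Z => h j (S' i)) μ := fun i =>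
        integrable_of_abs_le (hmi j i) (C := 1) fun S' => by
          rw [abs_of_nonneg (hI j _).1]; exact (hI j _).2
      have : ∑ i, ((∫ z, h j z ∂D) - h j (S i)) = ∫ S', ∑ i, (h j (S' i) - h j (S i)) ∂μ := by
        have hsub : ∀ i ∈ Finset.univ,
            Integrable (fun S' : Fin n → Z => h j (S' i) - h j (S i)) μ :=
          fun i _ => (hii i).sub (integrable_const _)
        rw [integral_finsetSum _ hsub]
        refine Finset.sum_congr rfl fun i _ => ?_
        rw [integral_sub (hii i) (integrable_const _), hE]
        simp
      rw [this]
      refine integral_mono (integrable_finsetSum _ fun i _ => (hii i).sub (integrable_const _))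
        (integrable_of_abs_le (hK2.comp measurable_prodMk_left) fun S' => hK2b (S, S')) fun S' => ?_
      exact le_ciSup (f := fun j => ∑ i, (h j (S' i) - h j (S i))) (Set.finite_range _).bddAbove j
  have step2 : ∫ S, ∫ S', ⨆ j, ∑ i, (h j (S' i) - h j (S i)) ∂μ ∂μ =
      ∫ T, ⨆ j, ∑ i, (h j (T i).2 - h j (T i).1) ∂π := by
    rw [← integral_prod _ hK2i]
    exact ((measurePreserving_arrowProdEquivProdArrow Z Z (Fin n) (fun _ => D)
      (fun _ => D)).integral_comp' _).symm
  have hKs : ∀ s : Fin n → ℝ, IsSignVector s →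
      Integrable (fun T : Fin n → Z × Z => ⨆ j, ∑ i, s i * (h j (T i).2 - h j (T i).1)) π := by
    intro s hs
    refine integrable_of_abs_le (C := n) (Measurable.iSup fun j => Finset.measurable_sum _
      fun i _ => Measurable.const_mul ?_ _) fun T => abs_iSup_le_of_finite fun j =>
        abs_sum_le_card fun i => ?_
    · exact ((hm j).comp (measurable_snd.comp (measurable_pi_apply i))).sub
        ((hm j).comp (measurable_fst.comp (measurable_pi_apply i)))
    · rw [abs_mul]
      rcases hs i with h1 | h1 <;> simpa [h1] using habs j _ _
  have step3 : ∫ T, ⨆ j, ∑ i, (h j (T i).2 - h j (T i).1) ∂π ≤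
      ∫ T, signAvg n (fun s => ⨆ j, ∑ i, s i * (h j (T i).2 - h j (T i).1)) ∂π := by
    rw [integral_signAvg hKs, ← signAvg_const (n := n) (∫ T, _ ∂π)]
    exact signAvg_mono fun s hs => (integral_iSup_sign_mul_sub h hm hs).ge
  have step4 : ∀ T : Fin n → Z × Z,
      signAvg n (fun s => ⨆ j, ∑ i, s i * (h j (T i).2 - h j (T i).1)) ≤ 2 * R := by
    intro T
    have h1 := hR fun i => (T i).2
    have h2 := hR fun i => (T i).1
    -- The first sample enters with a minus sign, which flipping all signs absorbs.
    rw [← signAvg_neg] at h2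
    calc _ ≤ signAvg n (fun s => (⨆ j, ∑ i, s i * h j (T i).2) +
          ⨆ j, ∑ i, -s i * h j (T i).1) := by
          refine signAvg_mono fun s _ => ciSup_le fun j => ?_
          have : ∑ i, s i * (h j (T i).2 - h j (T i).1) =
              (∑ i, s i * h j (T i).2) + ∑ i, -s i * h j (T i).1 := by
            rw [← Finset.sum_add_distrib]
            exact Finset.sum_congr rfl fun i _ => by ring
          rw [this]
          exact add_le_add
            (le_ciSup (f := fun j => ∑ i, s i * h j (T i).2) (Set.finite_range _).bddAbove j)
            (le_ciSup (f := fun j => ∑ i, -s i * h j (T i).1) (Set.finite_range _).bddAbove j)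
      _ ≤ 2 * R := by rw [signAvg_add]; linarith
  refine step1.trans (step2.trans_le (step3.trans ?_))
  simpa using integral_mono (integrable_signAvg hKs) (integrable_const (2 * R)) step4

/-- Uniform deviations of a finite class in terms of a bound `R` on its Rademacher complexity
(without the normalizing factor `1 / n`). -/
lemma measure_exists_deviation_le [Nonempty ι] {n : ℕ} (h : ι → Z → ℝ)
    (hm : ∀ j, Measurable (h j)) (hI : ∀ j z, h j z ∈ Set.Icc (0 : ℝ) 1) {R : ℝ}
    (hR : ∀ S : Fin n → Z, signAvg n (fun s => ⨆ j, ∑ i, s i * h j (S i)) ≤ R) {ε : ℝ}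
    (hε : 0 ≤ ε) :
    (Measure.pi fun _ : Fin n => D) {S | ∃ j, 2 * R + n * ε < ∑ i, (trueRisk D (h j) - h j (S i))} ≤
      ENNReal.ofReal (Real.exp (-(2 * n * ε ^ 2))) := by
  set F : (Fin n → Z) → ℝ := fun S => ⨆ j, ∑ i, (trueRisk D (h j) - h j (S i)) with hF
  have hFm : Measurable F := Measurable.iSup fun j => Finset.measurable_sum _ fun i _ =>
    ((hm j).comp (measurable_pi_apply i)).const_sub _
  have hFC : ∀ S, |F S| ≤ n := fun S => abs_iSup_le_of_finite fun j =>
    abs_sum_le_card fun i => abs_integral_sub_le_one (hm j) (hI j) _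
  have hFd : ∀ S i z, |F (Function.update S i z) - F S| ≤ 1 := fun S i z => by
    refine abs_iSup_sub_iSup_le fun j => ?_
    rw [← Finset.sum_sub_distrib, Finset.sum_eq_single i]
    · have h1 := hI j z
      have h2 := hI j (S i)
      rw [Function.update_self, abs_le]
      constructor <;> linarith [h1.1, h1.2, h2.1, h2.2]
    · intro k _ hk
      rw [Function.update_of_ne hk, sub_self]
    · simp
  have h1 := measure_integral_add_le_of_boundedDifferences (D := D) hFm hFC hFd hε
  have h2 : ∫ S, F S ∂Measure.pi (fun _ => D) ≤ 2 * R := integral_iSup_deviation_le h hm hI hR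
  refine (measure_mono ?_).trans ((ofReal_measureReal).symm.trans_le (ENNReal.ofReal_le_ofReal h1))
  rintro S ⟨j, hj⟩
  have : ∑ i, (trueRisk D (h j) - h j (S i)) ≤ F S :=
    le_ciSup (f := fun j => ∑ i, (trueRisk D (h j) - h j (S i))) (Set.finite_range _).bddAbove j
  change ∫ S, F S ∂Measure.pi (fun _ => D) + n * ε ≤ F S
  linarith

end Symmetrization

/-! ### Counting trees -/

lemma catalan_succ_le (n : ℕ) : catalan (n + 1) ≤ 4 * catalan n := by
  have h1 := succ_mul_catalan_eq_centralBinom n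
  have h2 := succ_mul_catalan_eq_centralBinom (n + 1)
  have h3 := Nat.succ_mul_centralBinom_succ n
  rw [← h1, ← h2] at h3
  have h4 : (n + 1) * ((n + 2) * catalan (n + 1)) = (n + 1) * (2 * (2 * n + 1) * catalan n) := by
    rw [show n + 2 = n + 1 + 1 from rfl, h3]; ring
  have h5 := Nat.eq_of_mul_eq_mul_left n.succ_pos h4
  nlinarith

/-- Consecutive terms grow by a factor at most `8`, while the factorial grows at least as fast from
`k = 7` on; smaller cases are computed. -/
lemma sum_catalan_mul_two_pow_le {k : ℕ} (hk : 1 ≤ k) :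
    ∑ j ∈ Finset.range (k + 1), catalan j * 2 ^ j ≤ 8 * k * k.factorial := by
  have step : ∀ k, ∑ j ∈ Finset.range (k + 2), catalan j * 2 ^ j ≤
      1 + 8 * ∑ j ∈ Finset.range (k + 1), catalan j * 2 ^ j := by
    intro k
    rw [Finset.sum_range_succ', Finset.mul_sum, add_comm]
    refine Nat.add_le_add (by simp) (Finset.sum_le_sum fun j _ => ?_)
    rw [pow_succ]
    nlinarith [catalan_succ_le j, Nat.one_le_two_pow (n := j)]
  have large : ∀ k, ∑ j ∈ Finset.range (k + 7 + 1), catalan j * 2 ^ j ≤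
      8 * (k + 7) * (k + 7).factorial := by
    intro k
    induction k with
    | zero =>
      simp only [Finset.sum_range_succ, Finset.sum_range_zero, catalan_eq_centralBinom_div]
      decide
    | succ k ih =>
      have h := step (k + 7)
      have h1 := (k + 7).factorial_pos
      rw [show k + 1 + 7 = k + 7 + 1 by ring, Nat.factorial_succ]
      generalize (k + 7).factorial = F at *
      refine h.trans ((Nat.add_le_add_left (Nat.mul_le_mul_left 8 ih) 1).trans ?_)
      nlinarith [Nat.zero_le (k ^ 2 * F), Nat.zero_le (k * F)]
  by_cases h7 : k < 7
  · interval_cases k <;>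
      simp only [Finset.sum_range_succ, Finset.sum_range_zero, catalan_eq_centralBinom_div] <;>
      decide
  · obtain ⟨c, rfl⟩ := Nat.exists_eq_add_of_le' (not_lt.1 h7)
    exact large c

namespace LabeledTree

variable {p q : ℕ}

lemma mul_pos_of_labeledTree (f : LabeledTree p q) : 0 < p * q := by
  induction f with
  | leaf i j => exact Nat.mul_pos j.pos i.pos
  | node op l r hl hr => exact hl

/-- With `j` operations there are `catalan j` shapes, two labels per operation and `p * q` labels
per leaf. The induction splits at the root, matching the Catalan recursion. -/
lemma exists_finset_numLeaves_eq (j : ℕ) : ∃ T : Finset (LabeledTree p q),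
    (∀ f : LabeledTree p q, f.numLeaves = j + 1 → f ∈ T) ∧
      T.card ≤ catalan j * 2 ^ j * (p * q) ^ (j + 1) := by
  classical
  induction j using Nat.strong_induction_on with
  | _ j ih =>
  cases j with
  | zero =>
    refine ⟨Finset.univ.image fun a : Fin q × Fin p => leaf a.1 a.2, fun f hf => ?_, ?_⟩
    · cases f with
      | leaf i j => exact Finset.mem_image.2 ⟨(i, j), Finset.mem_univ _, rfl⟩
      | node op l r =>
        have := l.numLeaves_pos
        have := r.numLeaves_pos
        simp only [numLeaves] at hf
        omega
    · refine Finset.card_image_le.trans ?_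
      simp [mul_comm]
  | succ j =>
    choose! T hT hcard using ih
    let N : NodeOp → ℕ × ℕ → Finset (LabeledTree p q) := fun op a =>
      (T a.1 ×ˢ T a.2).image fun b => node op b.1 b.2
    have hN : ∀ op, ∀ a ∈ Finset.HasAntidiagonal.antidiagonal j, (N op a).card ≤
        catalan a.1 * catalan a.2 * (2 ^ j * (p * q) ^ (j + 2)) := by
      intro op a ha
      have ha' := Finset.HasAntidiagonal.mem_antidiagonal.1 ha
      refine Finset.card_image_le.trans ?_
      rw [Finset.card_product]
      refine (Nat.mul_le_mul (hcard a.1 (by omega)) (hcard a.2 (by omega))).trans (le_of_eq ?_)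
      rw [← ha']
      ring
    refine ⟨(Finset.HasAntidiagonal.antidiagonal j).biUnion fun a => N .add a ∪ N .mul a, fun f hf => ?_, ?_⟩
    · cases f with
      | leaf i j => simp [numLeaves] at hf
      | node op l r =>
        have h1 := l.numLeaves_pos
        have h2 := r.numLeaves_pos
        simp only [numLeaves] at hf
        obtain ⟨a, ha⟩ := Nat.exists_eq_add_of_le' h1
        obtain ⟨b, hb⟩ := Nat.exists_eq_add_of_le' h2
        have hmem : node op l r ∈ N op (a, b) := Finset.mem_image.2
          ⟨(l, r), Finset.mem_product.2 ⟨hT a (by omega) l ha, hT b (by omega) r hb⟩, rfl⟩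
        refine Finset.mem_biUnion.2 ⟨(a, b), Finset.HasAntidiagonal.mem_antidiagonal.2 (by simp only; omega), ?_⟩
        cases op with
        | add => exact Finset.mem_union_left _ hmem
        | mul => exact Finset.mem_union_right _ hmem
    · calc _ ≤ ∑ a ∈ Finset.HasAntidiagonal.antidiagonal j, (N .add a ∪ N .mul a).card := Finset.card_biUnion_le
        _ ≤ ∑ a ∈ Finset.HasAntidiagonal.antidiagonal j,
            catalan a.1 * catalan a.2 * (2 * (2 ^ j * (p * q) ^ (j + 2))) :=
          Finset.sum_le_sum fun a ha => by
            have := Finset.card_union_le (N .add a) (N .mul a)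
            have := hN .add a ha
            have := hN .mul a ha
            linarith
        _ = _ := by rw [← Finset.sum_mul, catalan_succ']; ring

/-- The number of labeled binary trees with at most `2 * k + 1` nodes. -/
lemma exists_finset_treeClass_subset {k : ℕ} (hk : 1 ≤ k) (hpq : 0 < p * q) :
    ∃ T : Finset (LabeledTree p q), (∀ f ∈ treeClass p q (2 * k + 1), f ∈ T) ∧
      T.card ≤ 8 * k * k.factorial * (p * q) ^ (k + 1) := by
  classical
  choose T hT hcard using exists_finset_numLeaves_eq (p := p) (q := q)
  refine ⟨(Finset.range (k + 1)).biUnion T, fun f hf => ?_, ?_⟩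
  · have h1 := f.numNodes_add_one
    obtain ⟨a, ha⟩ := Nat.exists_eq_add_of_le' f.numLeaves_pos
    have hf' : f.numNodes ≤ 2 * k + 1 := hf
    exact Finset.mem_biUnion.2 ⟨a, Finset.mem_range.2 (by omega), hT a f ha⟩
  · calc _ ≤ ∑ j ∈ Finset.range (k + 1), (T j).card := Finset.card_biUnion_le
      _ ≤ ∑ j ∈ Finset.range (k + 1), catalan j * 2 ^ j * (p * q) ^ (k + 1) :=
        Finset.sum_le_sum fun j hj => (hcard j).trans <| Nat.mul_le_mul_left _ <|
          Nat.pow_le_pow_right hpq (Finset.mem_range.1 hj)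
      _ ≤ _ := by
        rw [← Finset.sum_mul]
        exact Nat.mul_le_mul_right _ (sum_catalan_mul_two_pow_le hk)

end LabeledTree

/-! ### Deviation bound for one tree -/

namespace LabeledTree

variable {p q : ℕ}

lemma measurable_eval {φ : ℕ → ℝ → ℝ} (hφ : ∀ l, Measurable (φ l)) (f : LabeledTree p q)
    (w : Fin f.numLeaves → ℝ) : Measurable fun x => f.eval φ x w := by
  induction f with
  | leaf i j => exact ((hφ i).comp (measurable_pi_apply j)).const_mul _
  | node op l r hl hr =>
    cases op with
    | add => exact (hl _).add (hr _)
    | mul => exact (hl _).mul (hr _)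

lemma continuous_eval (φ : ℕ → ℝ → ℝ) (x : Fin p → ℝ) (f : LabeledTree p q) :
    Continuous fun w : Fin f.numLeaves → ℝ => f.eval φ x w := by
  induction f with
  | leaf i j => exact (continuous_apply (0 : Fin 1)).mul continuous_const
  | node op l r hl hr =>
    have h1 : Continuous fun w : Fin (l.numLeaves + r.numLeaves) → ℝ =>
        l.eval φ x fun a => w (Fin.castAdd r.numLeaves a) :=
      hl.comp (continuous_pi fun a => continuous_apply _)
    have h2 : Continuous fun w : Fin (l.numLeaves + r.numLeaves) → ℝ =>
        r.eval φ x fun a => w (Fin.natAdd l.numLeaves a) :=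
      hr.comp (continuous_pi fun a => continuous_apply _)
    cases op with
    | add => exact h1.add h2
    | mul => exact h1.mul h2

/-- The uniform deviation bound for the losses of a single tree. -/
lemma exists_bad_samples {n : ℕ} (hn : 1 ≤ n) {φ : ℕ → ℝ → ℝ} (hφ_meas : ∀ l, Measurable (φ l))
    (hφ : ∀ l t, φ l t ∈ Set.Icc (-1 : ℝ) 1) {Y : Set ℝ} {d : Y → ℝ → ℝ}
    (hd_meas : Measurable (Function.uncurry d)) (hd : ∀ y t, d y t ∈ Set.Icc (0 : ℝ) 1)
    (hd_lip : ∀ y, LipschitzWith 1 (d y)) (D : Measure ((Fin p → ℝ) × Y)) [IsProbabilityMeasure D]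
    (f : LabeledTree p q) {ε : ℝ} (hε : 0 ≤ ε) :
    ∃ E : Set (Fin n → (Fin p → ℝ) × Y), MeasurableSet E ∧
      Measure.pi (fun _ => D) E ≤ ENNReal.ofReal (Real.exp (-(2 * n * ε ^ 2))) ∧
      ∀ S ∉ E, ∀ h ∈ lossClass φ d f,
        trueRisk D h ≤ empiricalRisk S h + 2 * Real.sqrt (f.numLeaves / n) + ε := by
  have hn0 : (0 : ℝ) < n := Nat.cast_pos.2 hn
  let B := {w : Fin f.numLeaves → ℝ // ∑ a, |w a| ≤ 1}
  have : Nonempty B := ⟨⟨0, by simp⟩⟩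
  let ℓ : B → (Fin p → ℝ) × Y → ℝ := fun w z => d z.2 (f.eval φ z.1 w.1)
  -- Only countably many weights are tested, so that the bad event is measurable.
  let u : ℕ → B := TopologicalSpace.denseSeq B
  have hℓm : ∀ w, Measurable (ℓ w) := fun w =>
    hd_meas.comp (measurable_snd.prodMk ((f.measurable_eval hφ_meas w.1).comp measurable_fst))
  have hℓI : ∀ w z, ℓ w z ∈ Set.Icc (0 : ℝ) 1 := fun w z => hd _ _
  have hℓc : ∀ z, Continuous fun w => ℓ w z := fun z =>
    (hd_lip z.2).continuous.comp ((f.continuous_eval φ z.1).comp continuous_subtype_val)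
  set R : ℝ := Real.sqrt (f.numLeaves * n) with hR
  let V : ℕ → Set (Fin n → (Fin p → ℝ) × Y) := fun j =>
    {S | 2 * R + n * ε < ∑ i, (trueRisk D (ℓ (u j)) - ℓ (u j) (S i))}
  have hVm : ∀ j, MeasurableSet (V j) := fun j =>
    measurableSet_lt measurable_const <| Finset.measurable_sum _ fun i _ =>
      ((hℓm (u j)).comp (measurable_pi_apply i)).const_sub _
  refine ⟨⋃ j, V j, MeasurableSet.iUnion hVm, ?_, ?_⟩
  -- The bound for the first `N + 1` weights does not depend on `N`, hence survives the increasing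
  -- union.
  · let W : ℕ → Set (Fin n → (Fin p → ℝ) × Y) := fun N =>
      {S | ∃ j : Fin (N + 1), 2 * R + n * ε < ∑ i, (trueRisk D (ℓ (u j)) - ℓ (u j) (S i))}
    have hWmono : Monotone W := by
      rintro a b hab S ⟨j, hj⟩
      exact ⟨⟨j, by omega⟩, hj⟩
    have hVW : ⋃ j, V j ⊆ ⋃ N, W N :=
      Set.iUnion_mono fun j S hS => ⟨⟨j, by omega⟩, hS⟩
    refine (measure_mono hVW).trans ?_
    rw [hWmono.measure_iUnion]
    refine iSup_le fun N => ?_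
    refine measure_exists_deviation_le (fun j : Fin (N + 1) => ℓ (u j)) (fun j => hℓm _)
      (fun j z => hℓI _ _) (fun S => ?_) hε
    have h1 := signAvg_contraction (fun _ => 0)
      (fun (j : Fin (N + 1)) i => f.eval φ (S i).1 (u j).1) fun i => hd_lip (S i).2
    simp only [zero_add] at h1
    exact h1.trans (f.signAvg_iSup_eval_le hφ hn (fun i => (S i).1) (fun j : Fin (N + 1) => (u j).1)
      fun j => (u j).2)
  · rintro S hS _ ⟨_, ⟨w, hw, rfl⟩, rfl⟩
    -- Both risks are continuous in the weights, the true one by dominated convergence, so the bound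
    -- extends from the dense sequence to all of `B`.
    have hcont : Continuous fun w : B => ∑ i, (trueRisk D (ℓ w) - ℓ w (S i)) := by
      refine continuous_finsetSum _ fun i _ => Continuous.sub ?_ (hℓc _)
      refine continuous_of_dominated (bound := fun _ => 1)
        (fun w => (hℓm w).aestronglyMeasurable) (fun w => ae_of_all _ fun z => ?_)
        (integrable_const _) (ae_of_all _ hℓc)
      rw [Real.norm_of_nonneg (hℓI w z).1]
      exact (hℓI w z).2
    have hall : ∀ w : B, ∑ i, (trueRisk D (ℓ w) - ℓ w (S i)) ≤ 2 * R + n * ε := fun w =>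
      (TopologicalSpace.denseRange_denseSeq B).induction_on w
        (isClosed_le hcont continuous_const) fun j => not_lt.1 fun hj => hS (Set.mem_iUnion.2 ⟨j, hj⟩)
    have h := hall ⟨w, hw⟩
    change trueRisk D (ℓ ⟨w, hw⟩) ≤ empiricalRisk S (ℓ ⟨w, hw⟩) + _ + _
    rw [Finset.sum_sub_distrib, Finset.sum_const, Finset.card_univ, Fintype.card_fin,
      nsmul_eq_mul] at h
    have hRn : R = n * Real.sqrt (f.numLeaves / n) := by
      rw [hR, show (f.numLeaves : ℝ) * n = n ^ 2 * (f.numLeaves / n) by field_simp,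
        Real.sqrt_mul (by positivity), Real.sqrt_sq hn0.le]
    have he : n * empiricalRisk S (ℓ ⟨w, hw⟩) = ∑ i, ℓ ⟨w, hw⟩ (S i) := by
      rw [empiricalRisk, ← mul_assoc, mul_one_div_cancel hn0.ne', one_mul]
    rw [hRn, ← he] at h
    refine le_of_mul_le_mul_left ?_ hn0
    linarith

end LabeledTree

/-! ### Union bound over trees -/

theorem theorem1 {p q k n : ℕ} (hk : 1 ≤ k) (hn : 1 ≤ n)
    (φ : ℕ → ℝ → ℝ) (hφ_meas : ∀ l, Measurable (φ l)) (hφ : ∀ l t, φ l t ∈ Set.Icc (-1 : ℝ) 1)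
    (Y : Set ℝ) (d : Y → ℝ → ℝ) (hd_meas : Measurable (Function.uncurry d))
    (hd : ∀ y t, d y t ∈ Set.Icc (0 : ℝ) 1) (hd_lip : ∀ y, LipschitzWith 1 (d y))
    (D : Measure ((Fin p → ℝ) × Y)) [IsProbabilityMeasure D]
    {Ω : Type*} [MeasurableSpace Ω] (P : Measure Ω) [IsProbabilityMeasure P]
    (z : Fin n → Ω → (Fin p → ℝ) × Y) (hz_meas : ∀ i, Measurable (z i))
    (hz_indep : iIndepFun z P) (hz_law : ∀ i, P.map (z i) = D)
    (δ : ℝ) (hδ : δ ∈ Set.Ioo (0 : ℝ) 1) :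
    ∃ A : Set Ω, MeasurableSet A ∧ ENNReal.ofReal (1 - δ) ≤ P A ∧
      ∀ ω ∈ A, ∀ f ∈ treeClass p q (2 * k + 1), ∀ h ∈ lossClass φ d f,
        trueRisk D h ≤ empiricalRisk (fun i => z i ω) h
          + 2 * Real.sqrt (((k : ℝ) + 1) / n)
          + Real.sqrt ((((k : ℝ) + 1) * Real.log ((p : ℝ) * q)
              + Real.log (8 * (k : ℝ) * (Nat.factorial k : ℝ)) + Real.log (1 / δ)) / (2 * n)) := by
  obtain ⟨hδ0, hδ1⟩ := hδ
  by_cases hpq : 0 < p * q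
  swap
  -- If `p * q = 0` no leaf can be labeled, so there are no trees.
  · refine ⟨Set.univ, MeasurableSet.univ, ?_, fun ω _ f => absurd f.mul_pos_of_labeledTree hpq⟩
    rw [measure_univ, ← ENNReal.ofReal_one]
    exact ENNReal.ofReal_le_ofReal (by linarith)
  have hn0 : (0 : ℝ) < n := Nat.cast_pos.2 hn
  have hpq0 : (0 : ℝ) < (p : ℝ) * q := by exact_mod_cast hpq
  obtain ⟨T, hT, hcard⟩ := LabeledTree.exists_finset_treeClass_subset (p := p) (q := q) hk hpq
  set N : ℕ := 8 * k * k.factorial * (p * q) ^ (k + 1) with hN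
  have hN1 : 1 ≤ N := Nat.mul_pos (Nat.mul_pos (by omega) k.factorial_pos) (pow_pos hpq _)
  have hN0 : (0 : ℝ) < N := Nat.cast_pos.2 hN1
  set L : ℝ := ((k : ℝ) + 1) * Real.log ((p : ℝ) * q)
    + Real.log (8 * (k : ℝ) * (Nat.factorial k : ℝ)) + Real.log (1 / δ) with hL
  have hLeq : L = Real.log (N / δ) := by
    have hk0 : (0 : ℝ) < 8 * (k : ℝ) * (Nat.factorial k : ℝ) :=
      mul_pos (mul_pos (by norm_num) (Nat.cast_pos.2 hk)) (Nat.cast_pos.2 k.factorial_pos)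
    rw [div_eq_mul_one_div, Real.log_mul hN0.ne' (by positivity), hL, hN]
    push_cast
    rw [Real.log_mul hk0.ne' (by positivity), Real.log_pow]
    push_cast
    ring
  have hNδ : 1 ≤ N / δ := by
    rw [le_div_iff₀ hδ0]
    have : (1 : ℝ) ≤ N := by exact_mod_cast hN1
    linarith
  have hL0 : 0 ≤ L := hLeq ▸ Real.log_nonneg hNδ
  set ε : ℝ := Real.sqrt (L / (2 * n)) with hε
  -- Since `L = log (N / δ)`, each of the at most `N` trees fails with probability at most `δ / N`.
  have hexp : Real.exp (-(2 * n * ε ^ 2)) = δ / N := by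
    rw [hε, Real.sq_sqrt (by positivity), mul_div_cancel₀ _ (by positivity), hLeq, Real.exp_neg,
      Real.exp_log (by positivity), inv_div]
  choose E hEm hE hbound using fun f : LabeledTree p q =>
    LabeledTree.exists_bad_samples hn hφ_meas hφ hd_meas hd hd_lip D f (Real.sqrt_nonneg (L / (2 * n)))
  have hZ : Measurable fun ω i => z i ω := measurable_pi_iff.2 hz_meas
  have hmap : P.map (fun ω i => z i ω) = Measure.pi fun _ => D := by
    rw [(iIndepFun_iff_map_fun_eq_pi_map fun i => (hz_meas i).aemeasurable).1 hz_indep]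
    simp only [hz_law]
  have hUm : MeasurableSet (⋃ f ∈ T, E f) := T.measurableSet_biUnion fun f _ => hEm f
  have hU : Measure.pi (fun _ => D) (⋃ f ∈ T, E f) ≤ ENNReal.ofReal δ := by
    calc _ ≤ ∑ f ∈ T, Measure.pi (fun _ => D) (E f) := measure_biUnion_finset_le _ _
      _ ≤ ∑ _f ∈ T, ENNReal.ofReal (δ / N) :=
        Finset.sum_le_sum fun f _ => (hE f).trans_eq (by rw [hexp])
      _ = ENNReal.ofReal (T.card * (δ / N)) := by
        rw [Finset.sum_const, nsmul_eq_mul, ENNReal.ofReal_mul (Nat.cast_nonneg _),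
          ENNReal.ofReal_natCast]
      _ ≤ ENNReal.ofReal δ := by
        refine ENNReal.ofReal_le_ofReal ?_
        have : (T.card : ℝ) ≤ N := Nat.cast_le.2 hcard
        calc (T.card : ℝ) * (δ / N) ≤ N * (δ / N) := by gcongr
          _ = δ := by field_simp
  refine ⟨(fun ω i => z i ω) ⁻¹' (⋃ f ∈ T, E f)ᶜ, hZ hUm.compl, ?_, ?_⟩
  · rw [← Measure.map_apply hZ hUm.compl, hmap, prob_compl_eq_one_sub hUm,
      ENNReal.ofReal_sub _ hδ0.le, ENNReal.ofReal_one]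
    exact tsub_le_tsub_left hU 1
  · intro ω hω f hf h hh
    have hmem : (fun i => z i ω) ∉ E f := fun hE =>
      hω (Set.mem_biUnion (Finset.mem_coe.2 (hT f hf)) hE)
    refine (hbound f _ hmem h hh).trans ?_
    have hleaves : (f.numLeaves : ℝ) ≤ (k : ℝ) + 1 := by
      have h1 := f.numNodes_add_one
      have h2 : f.numNodes ≤ 2 * k + 1 := hf
      exact_mod_cast (by omega : f.numLeaves ≤ k + 1)
    gcongr
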